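/- Let $b\ge 1$ be an integer and let $\mathcal V=(V_1,\dots,V_b)$ be a random vector (the split vector) with $V_i\ge 0$, $\sum_{i=1}^b V_i=1$ almost surely and identically distributed components; let $V$ be a random variable with the common distribution of the $V_i$. Assume that $\mathbf P(V=1)=\mathbf P(V=0)=0$ and that $-\ln V$ is non-lattice, i.e. there is no $d>0$ such that $-\ln V\in d\mathbb Z$ almost surely. Let $\Delta$ be the size-biased pick from $\mathcal V$: given $\mathcal V$, $\Delta=V_j$ with probability $V_j$, that is, $\mathbf P(\Delta\in A)=\sum_{j=1}^b\mathbf E\big(V_j\mathbf 1\{V_j\in A\}\big)$. Let $\mu:=\mathbf E(-\ln\Delta)$. Let $W_1,W_2,\dots$ be independent random variables distributed as $V$, put $Y_k:=-\sum_{j=1}^k\ln W_j$ and $$U(t):=\sum_{k=1}^\infty b^k\,\mathbf P(Y_k\le t).$$ Then $0<\mu<\infty$, the series defining $U(t)$ converges for every $t\in\mathbb R$, and $$U(t)=(\mu^{-1}+o(1))\,e^t\qquad\text{as } t\to\infty.$$ -/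

import Mathlib

open MeasureTheory ProbabilityTheory Filter Topology Asymptotics

noncomputable section

namespace SplitTree

/-- `S` is a split vector with branch factor `b` on the probability space `(Ω, P)`: a random
probability vector `(S 1, …, S b)` whose components are identically distributed. -/
structure IsSplitVector {Ω : Type*} [MeasurableSpace Ω] (P : Measure Ω) {b : ℕ}
    (S : Ω → Fin b → ℝ) : Prop where
  measurable : Measurable S
  nonneg : ∀ᵐ ω ∂P, ∀ i, 0 ≤ S ω i
  sum_eq_one : ∀ᵐ ω ∂P, ∑ i, S ω i = 1
  identDistrib : ∀ i j, IdentDistrib (fun ω => S ω i) (fun ω => S ω j) P P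

/-- The law of the size-biased pick `Δ` from the vector `S`: given `S`, `Δ = S j` with
probability `S j`. Thus `P(Δ ∈ A) = ∑ j, E[S j ; S j ∈ A]`. -/
def sizeBiasedLaw {Ω : Type*} [MeasurableSpace Ω] (P : Measure Ω) {b : ℕ}
    (S : Ω → Fin b → ℝ) : Measure ℝ :=
  ∑ j, (P.withDensity (fun ω => ENNReal.ofReal (S ω j))).map (fun ω => S ω j)

/-- `μ = E(-ln Δ)`. -/
def mu {Ω : Type*} [MeasurableSpace Ω] (P : Measure Ω) {b : ℕ} (S : Ω → Fin b → ℝ) : ℝ :=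
  ∫ x, -Real.log x ∂(sizeBiasedLaw P S)

/-- A real random variable is lattice if it is almost surely concentrated on the integer
multiples of some `d > 0`. -/
def IsLattice {Ω : Type*} [MeasurableSpace Ω] (P : Measure Ω) (X : Ω → ℝ) : Prop :=
  ∃ d : ℝ, 0 < d ∧ ∀ᵐ ω ∂P, ∃ n : ℤ, X ω = n * d

/-- `Y_k = -∑_{j=1}^k ln W_j`; the sequence `W_1, W_2, …` is indexed here from `0`. -/
def Y {Ω : Type*} (W : ℕ → Ω → ℝ) (k : ℕ) (ω : Ω) : ℝ :=
  -∑ j ∈ Finset.range k, Real.log (W j ω)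

/-- `ν_k(t) = b^k P(Y_k ≤ t)`. -/
def nu {Ω : Type*} [MeasurableSpace Ω] (P : Measure Ω) (b : ℕ) (W : ℕ → Ω → ℝ)
    (k : ℕ) (t : ℝ) : ℝ :=
  (b : ℝ) ^ k * P.real {ω | Y W k ω ≤ t}

/-- The renewal function `U(t) = ∑_{k=1}^∞ ν_k(t)`. -/
def renewalU {Ω : Type*} [MeasurableSpace Ω] (P : Measure Ω) (b : ℕ) (W : ℕ → Ω → ℝ)
    (t : ℝ) : ℝ :=
  ∑' k : ℕ, nu P b W (k + 1) t

end SplitTree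

end

/-! Write φ(z) = b E V^z, which appears in the code as b times `complexMGF` of log V. Independence
gives E exp(-z Y_k) = (E V^z)^k, so the Laplace transform of ν_k is φ(z)^k / z. Taking expectations
in ∑ V_i = 1 gives φ(1) = b E V = 1. Since 0 < V < 1 almost surely, |φ| < 1 for Re z > 1, and there
U has transform φ / (1 - φ) / z. A Chernoff bound at a real exponent above 1 makes the series
converge.

At z = 1 the derivative is φ'(1) = b E(V ln V) = -μ, which is nonzero, so the transform has a simple
pole with residue 1/μ. Another zero of 1 - φ on Re z = 1, at 1 + iy, would force cos(y ln V) = 1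
almost surely, which the non-lattice hypothesis excludes (`complexMGF_log_one_add_I_mul_ne`). Hence
the transform minus its pole is continuous up to the line (`exists_continuousOn_eq_add_pole`), and
as U is monotone, `wiener_ikehara` yields U(t) e^{-t} → 1/μ.

The Tauberian theorem is proved with rescaled Fejér kernels K. Their Fourier transforms have compact
support, so the average of a(t) = f(t) e^{-t} against K equals its expected limit plus a Fourier
integral of a continuous compactly supported function, which vanishes by Riemann–Lebesgue
(`tendsto_integral_mul_kernel`). Monotonicity of f then replaces averages by pointwise values. -/

/-! ### Fejér kernels. -/

/-- The triangle function, supported on `[-1, 1]`. -/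
def triangle (y : ℝ) : ℝ := max (1 - |y|) 0

/-- The Fejér kernel, as the Fourier transform of the triangle function. -/
noncomputable def fejer (v : ℝ) : ℝ := ∫ y : ℝ, triangle y * Real.cos (y * v)

lemma continuous_triangle : Continuous triangle := by
  unfold triangle; fun_prop

lemma hasCompactSupport_triangle : HasCompactSupport triangle := by
  refine HasCompactSupport.intro (isCompact_Icc (a := (-1 : ℝ)) (b := 1)) fun y hy => ?_
  have : 1 < |y| := by
    by_contra h
    exact hy (abs_le.mp (not_lt.mp h))
  simp only [triangle]
  exact max_eq_right (by linarith)

lemma integrable_triangle_mul_cos (v : ℝ) :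
    Integrable fun y : ℝ => triangle y * Real.cos (y * v) :=
  (by have := continuous_triangle; fun_prop : Continuous _).integrable_of_hasCompactSupport
    hasCompactSupport_triangle.mul_right

lemma fejer_eq_intervalIntegral (v : ℝ) :
    fejer v = 2 * ∫ y in (0 : ℝ)..1, (1 - y) * Real.cos (y * v) := by
  have h1 : fejer v = ∫ y : ℝ, (fun u : ℝ => max (1 - u) 0 * Real.cos (u * v)) |y| := by
    refine integral_congr_ae (Eventually.of_forall fun y => ?_)
    simp only [triangle]
    rcases abs_cases y with h | h <;> simp [h.1]
  rw [h1, integral_comp_abs (f := fun u : ℝ => max (1 - u) 0 * Real.cos (u * v)),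
    intervalIntegral.integral_of_le zero_le_one]
  congr 1
  rw [setIntegral_eq_of_subset_of_forall_sdiff_eq_zero measurableSet_Ioi
    (fun y hy => hy.1 : Set.Ioc (0 : ℝ) 1 ⊆ Set.Ioi 0)]
  · refine setIntegral_congr_fun measurableSet_Ioc fun y hy => ?_
    have : (0 : ℝ) ≤ 1 - y := by linarith [hy.2]
    simp only [max_eq_left this]
  · rintro y ⟨h, h'⟩
    have : 1 - y ≤ 0 := by
      by_contra h1
      exact h' ⟨h, by linarith⟩
    simp [max_eq_right this]

/-- Integration by parts supplies the antiderivative. Keeping the factor v² avoids dividing at v =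
0; the identity yields both positivity and decay of order v⁻². -/
lemma fejer_mul_sq (v : ℝ) : fejer v * v ^ 2 = 2 * (1 - Real.cos v) := by
  have h : ∫ y in (0 : ℝ)..1, (1 - y) * Real.cos (y * v) * v ^ 2 =
      ((1 - 1) * Real.sin (1 * v) * v - Real.cos (1 * v)) -
        ((1 - 0) * Real.sin (0 * v) * v - Real.cos (0 * v)) := by
    refine intervalIntegral.integral_eq_sub_of_hasDerivAt
      (f := fun y => (1 - y) * Real.sin (y * v) * v - Real.cos (y * v)) (fun y _ => ?_)
      (Continuous.intervalIntegrable (by fun_prop) _ _)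
    have e : HasDerivAt (fun y : ℝ => y * v) v y := by
      simpa using (hasDerivAt_id y).mul_const v
    have := ((((hasDerivAt_id y).const_sub 1).mul e.sin).mul_const v).sub e.cos
    exact this.congr_deriv (by simp only [id]; ring)
  rw [intervalIntegral.integral_mul_const] at h
  rw [fejer_eq_intervalIntegral, mul_assoc, h]
  simp
  ring

lemma fejer_nonneg (v : ℝ) : 0 ≤ fejer v := by
  rcases eq_or_ne v 0 with rfl | hv
  · refine integral_nonneg fun y => ?_
    simp [triangle]
  · have h := fejer_mul_sq v
    have hv2 : 0 < v ^ 2 := by positivity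
    nlinarith [Real.cos_le_one v]

lemma continuous_fejer : Continuous fejer := by
  have : fejer = fun v => 2 * ∫ y in (0 : ℝ)..1, (1 - y) * Real.cos (y * v) :=
    funext fejer_eq_intervalIntegral
  rw [this]
  refine continuous_const.mul ?_
  exact intervalIntegral.continuous_parametric_intervalIntegral_of_continuous'
    (by unfold Function.uncurry; fun_prop) 0 1

lemma fejer_zero_pos : 0 < fejer 0 := by
  have : fejer 0 = ∫ y, triangle y := by simp [fejer]
  rw [this]
  refine Continuous.integral_pos_of_hasCompactSupport_nonneg_nonzero (x := 0)
    continuous_triangle hasCompactSupport_triangle (fun y => by simp [triangle]) ?_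
  simp [triangle]

lemma fejer_le_fejer_zero (v : ℝ) : fejer v ≤ fejer 0 := by
  refine integral_mono (integrable_triangle_mul_cos v) (integrable_triangle_mul_cos 0) fun y => ?_
  simp only [mul_zero, Real.cos_zero]
  exact mul_le_mul_of_nonneg_left (Real.cos_le_one _) (by simp [triangle])

lemma integrable_fejer : Integrable fejer := by
  -- The constant adds the bounds `fejer v ≤ fejer 0` and `fejer v * v ^ 2 ≤ 4`.
  refine (integrable_inv_one_add_sq.const_mul (fejer 0 + 4)).mono'
    continuous_fejer.aestronglyMeasurable (Eventually.of_forall fun v => ?_)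
  rw [Real.norm_of_nonneg (fejer_nonneg v), ← div_eq_mul_inv, le_div_iff₀ (by positivity)]
  have h1 := fejer_mul_sq v
  have h2 := fejer_le_fejer_zero v
  have h3 := Real.neg_one_le_cos v
  linarith

lemma integral_fejer_pos : 0 < ∫ v, fejer v := by
  rw [integral_pos_iff_support_of_nonneg fejer_nonneg integrable_fejer]
  exact continuous_fejer.isOpen_support.measure_pos _ ⟨0, fejer_zero_pos.ne'⟩

/-- The triangle is even, so averaging the integral with its reflection y ↦ -y turns the exponential
into a cosine. -/
lemma ofReal_fejer (v : ℝ) :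
    (fejer v : ℂ) = ∫ y : ℝ, (triangle y : ℂ) * Complex.exp (Complex.I * y * v) := by
  have hint : Integrable fun y : ℝ => (triangle y : ℂ) * Complex.exp (Complex.I * y * v) := by
    refine Continuous.integrable_of_hasCompactSupport
      (by have := continuous_triangle; fun_prop) ?_
    exact (hasCompactSupport_triangle.comp_left Complex.ofReal_zero).mul_right
  have hneg : ∫ y : ℝ, (triangle y : ℂ) * Complex.exp (Complex.I * y * v) =
      ∫ y : ℝ, (triangle y : ℂ) * Complex.exp (-(Complex.I * y * v)) := by
    rw [← integral_neg_eq_self]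
    refine integral_congr_ae (Eventually.of_forall fun y => ?_)
    simp [triangle]
  have hint' : Integrable fun y : ℝ => (triangle y : ℂ) * Complex.exp (-(Complex.I * y * v)) := by
    refine hint.comp_neg.congr (Eventually.of_forall fun y => ?_)
    simp [triangle]
  have h2 : (2 : ℂ) * ∫ y : ℝ, (triangle y : ℂ) * Complex.exp (Complex.I * y * v) =
      2 * (fejer v : ℂ) := by
    rw [two_mul]
    nth_rw 2 [hneg]
    rw [← integral_add hint hint', fejer, ← integral_complex_ofReal, ← integral_const_mul]
    refine integral_congr_ae (Eventually.of_forall fun y => ?_)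
    simp only [Complex.ofReal_mul, Complex.ofReal_cos, Complex.cos]
    rw [← mul_add, show Complex.I * y * v = (y * v : ℂ) * Complex.I by ring,
      show -((y * v : ℂ) * Complex.I) = -(y * v : ℂ) * Complex.I by ring]
    ring
  exact (mul_left_cancel₀ two_ne_zero h2).symm

/-- Approximate identities among the kernels with compactly supported Fourier transform. -/
lemma exists_bandlimited_kernel {δ η : ℝ} (hδ : 0 < δ) (hη : 0 < η) :
    ∃ (k : ℝ → ℂ) (K : ℝ → ℝ), Continuous k ∧ HasCompactSupport k ∧
      (∀ v : ℝ, (K v : ℂ) = ∫ y : ℝ, k y * Complex.exp (Complex.I * y * v)) ∧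
      (∀ v, 0 ≤ K v) ∧ Continuous K ∧ Integrable K ∧ ∫ v, K v = 1 ∧
      1 - η < ∫ v in Set.Icc (-δ) δ, K v := by
  set c := ∫ v, fejer v with hc
  have hc0 : 0 < c := integral_fejer_pos
  have hlim : Tendsto (fun n : ℝ => ∫ v in (-n)..n, fejer v) atTop (𝓝 c) :=
    intervalIntegral_tendsto_integral integrable_fejer tendsto_neg_atTop_atBot tendsto_id
  have hlt : (1 - η) * c < c := by nlinarith
  obtain ⟨n, hn, hn0⟩ := ((hlim.eventually_const_lt hlt).and (eventually_gt_atTop 0)).exists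
  -- Dilation by l carries the mass of `fejer` on [-n, n] to [-δ, δ].
  set l := n / δ with hl
  have hl0 : 0 < l := div_pos hn0 hδ
  refine ⟨fun y => (c⁻¹ : ℝ) * triangle (y / l), fun v => c⁻¹ * (l * fejer (v * l)), ?_, ?_, ?_,
    ?_, ?_, ?_, ?_, ?_⟩
  · have := continuous_triangle
    fun_prop
  · have h1 : HasCompactSupport fun y : ℝ => triangle (y / l) := by
      simpa [div_eq_mul_inv] using!
        hasCompactSupport_triangle.comp_homeomorph (Homeomorph.mulRight₀ l⁻¹ (by positivity))
    exact (h1.comp_left Complex.ofReal_zero).mul_left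
  · intro v
    have h1 := Measure.integral_comp_div
      (fun y : ℝ => (triangle y : ℂ) * Complex.exp (Complex.I * y * ((v * l : ℝ) : ℂ))) l
    rw [← ofReal_fejer, abs_of_pos hl0] at h1
    simp_rw [mul_assoc ((c⁻¹ : ℝ) : ℂ)]
    rw [integral_const_mul]
    push_cast at h1 ⊢
    rw [← Complex.real_smul, ← h1]
    congr 1
    refine integral_congr_ae (Eventually.of_forall fun y => ?_)
    have : (l : ℂ) ≠ 0 := by exact_mod_cast hl0.ne'
    simp only
    congr 2
    field_simp
  · intro v
    have := fejer_nonneg (v * l)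
    positivity
  · have := continuous_fejer
    fun_prop
  · exact ((integrable_fejer.comp_mul_right' hl0.ne').const_mul l).const_mul c⁻¹
  · rw [integral_const_mul, integral_const_mul, Measure.integral_comp_mul_right fejer l,
      abs_of_pos (inv_pos.mpr hl0), ← hc, smul_eq_mul]
    field_simp
  · rw [integral_Icc_eq_integral_Ioc, ← intervalIntegral.integral_of_le (by linarith),
      intervalIntegral.integral_const_mul, intervalIntegral.integral_const_mul,
      intervalIntegral.mul_integral_comp_mul_right]
    have : δ * l = n := by rw [hl]; field_simp
    rw [neg_mul, this, ← div_eq_inv_mul, lt_div_iff₀ hc0]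
    exact hn

/-! ### Convergence of averages against bandlimited kernels. -/

section BandlimitedKernel

variable {a : ℝ → ℝ} {A : ℝ} {H : ℂ → ℂ} {k : ℝ → ℂ} {K : ℝ → ℝ}

lemma norm_cexp_I_mul_mul (y v : ℝ) : ‖Complex.exp (Complex.I * y * v)‖ = 1 := by
  rw [show Complex.I * y * v = ((y * v : ℝ) : ℂ) * Complex.I by push_cast; ring]
  exact Complex.norm_exp_ofReal_mul_I _

/-- The Laplace transform along a vertical line, integrated against a bandlimited kernel. -/
lemma integral_mul_kernel_eq {g : ℝ → ℂ} {L : ℝ → ℂ} (hg : IntegrableOn g (Set.Ioi 0))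
    (hL : ∀ y : ℝ, ∫ t in Set.Ioi (0 : ℝ), g t * Complex.exp (-(Complex.I * y * t)) = L y)
    (hk : Continuous k) (hkc : HasCompactSupport k)
    (hK : ∀ v : ℝ, (K v : ℂ) = ∫ y : ℝ, k y * Complex.exp (Complex.I * y * v)) (x : ℝ) :
    ∫ t in Set.Ioi (0 : ℝ), g t * (K (x - t) : ℂ) =
      ∫ y : ℝ, k y * Complex.exp (Complex.I * y * x) * L y := by
  have hk1 : Integrable k := hk.integrable_of_hasCompactSupport hkc
  have hprod : Integrable (fun p : ℝ × ℝ =>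
      (g p.1 * k p.2) * Complex.exp (Complex.I * p.2 * ((x - p.1 : ℝ) : ℂ)))
      ((volume.restrict (Set.Ioi 0)).prod volume) := by
    refine (hg.mul_prod hk1).mul_bdd (c := 1) (Continuous.aestronglyMeasurable (by fun_prop)) ?_
    exact Eventually.of_forall fun p => (norm_cexp_I_mul_mul _ _).le
  calc ∫ t in Set.Ioi (0 : ℝ), g t * (K (x - t) : ℂ)
      = ∫ t in Set.Ioi (0 : ℝ), ∫ y : ℝ,
          (g t * k y) * Complex.exp (Complex.I * y * ((x - t : ℝ) : ℂ)) := by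
        refine integral_congr_ae (Eventually.of_forall fun t => ?_)
        simp only [hK, ← integral_const_mul, mul_assoc]
    _ = ∫ y : ℝ, ∫ t in Set.Ioi (0 : ℝ),
          (g t * k y) * Complex.exp (Complex.I * y * ((x - t : ℝ) : ℂ)) :=
        integral_integral_swap hprod
    _ = _ := by
        refine integral_congr_ae (Eventually.of_forall fun y => ?_)
        simp only [← hL, ← integral_const_mul]
        refine integral_congr_ae (Eventually.of_forall fun t => ?_)
        simp only
        rw [show Complex.I * y * ((x - t : ℝ) : ℂ) =
          Complex.I * y * x + -(Complex.I * y * t) by push_cast; ring, Complex.exp_add]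
        ring

/-- The right-hand side of the identity for a damped function, before the damping is removed. -/
lemma integral_sub_const_mul_exp_mul_kernel
    (hint : ∀ ε : ℝ, 0 < ε → IntegrableOn (fun t => a t * Real.exp (-(ε * t))) (Set.Ioi 0))
    (hLap : ∀ z : ℂ, 0 < z.re →
      ∫ t in Set.Ioi (0 : ℝ), (a t : ℂ) * Complex.exp (-(z * t)) = H z + A / z)
    (hk : Continuous k) (hkc : HasCompactSupport k)
    (hK : ∀ v : ℝ, (K v : ℂ) = ∫ y : ℝ, k y * Complex.exp (Complex.I * y * v))
    {ε : ℝ} (hε : 0 < ε) (x : ℝ) :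
    ((∫ t in Set.Ioi (0 : ℝ), (a t - A) * Real.exp (-(ε * t)) * K (x - t) : ℝ) : ℂ) =
      ∫ y : ℝ, k y * Complex.exp (Complex.I * y * x) * H (ε + Complex.I * y) := by
  have hexp : IntegrableOn (fun t : ℝ => Real.exp (-(ε * t))) (Set.Ioi 0) := by
    simpa [neg_mul] using integrableOn_exp_mul_Ioi (neg_lt_zero.mpr hε) 0
  have hg : IntegrableOn (fun t => (a t - A) * Real.exp (-(ε * t))) (Set.Ioi 0) := by
    simp_rw [sub_mul]
    exact (hint ε hε).sub (hexp.const_mul A)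
  rw [← integral_complex_ofReal]
  rw [← integral_mul_kernel_eq (g := fun t => (((a t - A) * Real.exp (-(ε * t)) : ℝ) : ℂ))
    hg.ofReal ?_ hk hkc hK x]
  · simp
  intro y
  have hz : 0 < (ε + Complex.I * y : ℂ).re := by simpa using hε
  have e : ∀ t : ℝ, Complex.exp (-((ε + Complex.I * y) * t)) =
      Complex.exp (-(ε * t)) * Complex.exp (-(Complex.I * y * t)) := fun t => by
    rw [← Complex.exp_add]; congr 1; ring
  have i1 : IntegrableOn (fun t : ℝ => (a t : ℂ) * Complex.exp (-((ε + Complex.I * y) * t)))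
      (Set.Ioi 0) := by
    have hI : IntegrableOn (fun t => ((a t * Real.exp (-(ε * t)) : ℝ) : ℂ)) (Set.Ioi 0) :=
      (hint ε hε).ofReal
    refine (hI.mul_bdd (c := 1)
      (g := fun t : ℝ => Complex.exp (-(Complex.I * y * t)))
      (Continuous.aestronglyMeasurable (by fun_prop)) ?_).congr
      (Eventually.of_forall fun t => ?_)
    · refine Eventually.of_forall fun t => ?_
      rw [Complex.exp_neg, norm_inv, norm_cexp_I_mul_mul, inv_one]
    · simp only [e]; push_cast; ring
  have i2 : IntegrableOn (fun t : ℝ => (A : ℂ) * Complex.exp (-((ε + Complex.I * y) * t)))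
      (Set.Ioi 0) := by
    have := integrableOn_exp_mul_complex_Ioi (a := -(ε + Complex.I * y)) (by simpa using hε) 0
    simp_rw [neg_mul] at this
    exact this.const_mul (A : ℂ)
  -- The transform of the constant A is exactly the pole term, so that of a - A is H alone.
  have h2 : ∫ t in Set.Ioi (0 : ℝ), (A : ℂ) * Complex.exp (-((ε + Complex.I * y) * t)) =
      A / (ε + Complex.I * y) := by
    have := integral_exp_mul_complex_Ioi (a := -(ε + Complex.I * y)) (by simpa using hε) 0
    rw [integral_const_mul]
    simp_rw [← neg_mul, this]
    rw [Complex.ofReal_zero, mul_zero, Complex.exp_zero, neg_div_neg_eq, mul_one_div]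
  have h1 := hLap _ hz
  calc _ = ∫ t in Set.Ioi (0 : ℝ), ((a t : ℂ) * Complex.exp (-((ε + Complex.I * y) * t)) -
        (A : ℂ) * Complex.exp (-((ε + Complex.I * y) * t))) := by
        refine integral_congr_ae (Eventually.of_forall fun t => ?_)
        simp only [e]; push_cast; ring
    _ = _ := by rw [integral_sub i1 i2, h1, h2]; ring

/-- Only y in the compact support of k matters. There H is bounded uniformly for real parts in [0,
1], so dominated convergence lets the damping tend to zero. -/
lemma tendsto_integral_kernel_mul_boundary (hH : ContinuousOn H {z | 0 ≤ z.re})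
    (hk : Continuous k) (hkc : HasCompactSupport k) (x : ℝ) :
    Tendsto (fun n : ℕ => ∫ y : ℝ, k y * Complex.exp (Complex.I * y * x) *
        H (((1 / (n + 1 : ℝ) : ℝ) : ℂ) + Complex.I * y)) atTop
      (𝓝 (∫ y : ℝ, k y * Complex.exp (Complex.I * y * x) * H (Complex.I * y))) := by
  set F : ℝ × ℝ → ℂ := fun p => ((p.1 : ℝ) : ℂ) + Complex.I * p.2 with hF
  have hFc : Continuous F := by fun_prop
  have hcomp : IsCompact (Set.Icc (0 : ℝ) 1 ×ˢ tsupport k) := isCompact_Icc.prod hkc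
  have hcont : ContinuousOn (fun p => H (F p)) (Set.Icc (0 : ℝ) 1 ×ˢ tsupport k) :=
    hH.comp hFc.continuousOn fun p hp => by simpa [hF] using hp.1.1
  obtain ⟨C, hC⟩ := hcomp.exists_bound_of_continuousOn hcont
  have hline : ∀ ε : ℝ, 0 ≤ ε → Continuous fun y : ℝ => H ((ε : ℂ) + Complex.I * y) := fun ε hε =>
    hH.comp_continuous (by fun_prop) fun y => by simpa using hε
  have hn0 : ∀ n : ℕ, (0 : ℝ) ≤ 1 / (n + 1 : ℝ) := fun n => by positivity
  have hn1 : ∀ n : ℕ, 1 / (n + 1 : ℝ) ≤ 1 := fun n => by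
    rw [div_le_one (by positivity)]; linarith [(Nat.cast_nonneg n : (0 : ℝ) ≤ n)]
  refine tendsto_integral_of_dominated_convergence (fun y => ‖k y‖ * C) (fun n => ?_) ?_
    (fun n => ?_) ?_
  · exact ((hk.mul (by fun_prop)).mul (hline _ (hn0 n))).aestronglyMeasurable
  · exact (hk.integrable_of_hasCompactSupport hkc).norm.mul_const C
  · refine Eventually.of_forall fun y => ?_
    rw [norm_mul, norm_mul, norm_cexp_I_mul_mul, mul_one]
    by_cases hy : y ∈ tsupport k
    · exact mul_le_mul_of_nonneg_left (hC (1 / (n + 1 : ℝ), y) ⟨⟨hn0 n, hn1 n⟩, hy⟩)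
        (norm_nonneg _)
    · simp [image_eq_zero_of_notMem_tsupport hy]
  · refine Eventually.of_forall fun y => Tendsto.const_mul _ ?_
    have h0 : ContinuousWithinAt H {z | 0 ≤ z.re} (Complex.I * y) := hH _ (by simp)
    refine h0.tendsto.comp (tendsto_nhdsWithin_iff.mpr ⟨?_, ?_⟩)
    · have h1 : Tendsto (fun n : ℕ => ((1 / (n + 1 : ℝ) : ℝ) : ℂ)) atTop (𝓝 ((0 : ℝ) : ℂ)) :=
        (Complex.continuous_ofReal.tendsto 0).comp tendsto_one_div_add_atTop_nhds_zero_nat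
      simpa using h1.add_const (Complex.I * (y : ℂ))
    · refine Eventually.of_forall fun n => ?_
      have hre : ∀ ε : ℝ, ((ε : ℂ) + Complex.I * y).re = ε := fun ε => by simp
      exact (hn0 n).trans_eq (hre _).symm

/-- This is the Riemann–Lebesgue lemma, with frequency -x/(2π) in the normalisation of
`Real.fourierChar`. -/
lemma tendsto_integral_kernel_mul_boundary_atTop (h : ℝ → ℂ) :
    Tendsto (fun x : ℝ => ∫ y : ℝ, h y * Complex.exp (Complex.I * y * x)) atTop (𝓝 0) := by
  have h1 := Real.tendsto_integral_exp_smul_cocompact h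
  have h2 : Tendsto (fun x : ℝ => -(x / (2 * Real.pi))) atTop (cocompact ℝ) := by
    refine Tendsto.mono_right ?_ atBot_le_cocompact
    exact tendsto_neg_atTop_atBot.comp (tendsto_id.atTop_div_const (by positivity))
  refine (h1.comp h2).congr fun x => ?_
  refine integral_congr_ae (Eventually.of_forall fun y => ?_)
  simp only [Circle.smul_def, Real.fourierChar_apply, smul_eq_mul]
  rw [mul_comm]
  congr 2
  have : (Real.pi : ℂ) ≠ 0 := by exact_mod_cast Real.pi_ne_zero
  push_cast
  field_simp

/-- The smoothed Tauberian conclusion. -/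
lemma tendsto_integral_mul_kernel (ha0 : ∀ t, 0 ≤ a t)
    (hint : ∀ ε : ℝ, 0 < ε → IntegrableOn (fun t => a t * Real.exp (-(ε * t))) (Set.Ioi 0))
    (hH : ContinuousOn H {z | 0 ≤ z.re})
    (hLap : ∀ z : ℂ, 0 < z.re →
      ∫ t in Set.Ioi (0 : ℝ), (a t : ℂ) * Complex.exp (-(z * t)) = H z + A / z)
    (hk : Continuous k) (hkc : HasCompactSupport k)
    (hK : ∀ v : ℝ, (K v : ℂ) = ∫ y : ℝ, k y * Complex.exp (Complex.I * y * v))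
    (hK0 : ∀ v, 0 ≤ K v) (hKc : Continuous K) (hKi : Integrable K) :
    (∀ x, IntegrableOn (fun t => a t * K (x - t)) (Set.Ioi 0)) ∧
    Tendsto (fun x => ∫ t in Set.Ioi (0 : ℝ), a t * K (x - t)) atTop (𝓝 (A * ∫ v, K v)) := by
  set R : ℝ → ℂ := fun x => ∫ y : ℝ, k y * Complex.exp (Complex.I * y * x) * H (Complex.I * y)
  set e : ℕ → ℝ → ℝ := fun n t => Real.exp (-((1 / (n + 1 : ℝ)) * t))
  have he0 : ∀ n t, 0 ≤ e n t := fun n t => (Real.exp_pos _).le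
  have he1 : ∀ n, ∀ t ∈ Set.Ioi (0 : ℝ), e n t ≤ 1 := fun n t ht => by
    have : 0 < t := ht
    exact Real.exp_le_one_iff.mpr (neg_nonpos.mpr (by positivity))
  have hlim : ∀ t, Tendsto (fun n => e n t) atTop (𝓝 1) := fun t => by
    have := ((tendsto_one_div_add_atTop_nhds_zero_nat (𝕜 := ℝ)).mul_const t).neg.rexp
    rw [zero_mul, neg_zero, Real.exp_zero] at this
    exact this
  have hec : ∀ n, Continuous (e n) := fun n => by fun_prop
  have hK1 : ∀ x, IntegrableOn (fun t => A * K (x - t)) (Set.Ioi 0) := fun x =>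
    ((hKi.comp_sub_left x).const_mul A).integrableOn
  have dom : ∀ (f : ℝ → ℝ), IntegrableOn f (Set.Ioi 0) →
      (∀ n, IntegrableOn (fun t => f t * e n t) (Set.Ioi 0)) ∧
      Tendsto (fun n => ∫ t in Set.Ioi (0 : ℝ), f t * e n t) atTop
        (𝓝 (∫ t in Set.Ioi (0 : ℝ), f t)) := by
    intro f hf
    have hb : ∀ n, ∀ᵐ t ∂(volume.restrict (Set.Ioi (0 : ℝ))), ‖f t * e n t‖ ≤ ‖f t‖ := fun n => by
      filter_upwards [self_mem_ae_restrict measurableSet_Ioi] with t ht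
      rw [norm_mul, Real.norm_of_nonneg (he0 n t)]
      exact mul_le_of_le_one_right (norm_nonneg _) (he1 n t ht)
    have hm : ∀ n, AEStronglyMeasurable (fun t => f t * e n t) (volume.restrict (Set.Ioi 0)) :=
      fun n => hf.1.mul (hec n).aestronglyMeasurable
    refine ⟨fun n => Integrable.mono hf (hm n) (hb n), ?_⟩
    refine tendsto_integral_of_dominated_convergence (fun t => ‖f t‖) hm hf.norm hb ?_
    exact Eventually.of_forall fun t => by simpa using (hlim t).const_mul (f t)
  -- As a Fourier transform, K is bounded by the L¹ norm of k.
  obtain ⟨B, hB⟩ : ∃ B, ∀ v, ‖K v‖ ≤ B := by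
    refine ⟨∫ y, ‖k y‖, fun v => ?_⟩
    rw [← Complex.norm_real, hK]
    refine (norm_integral_le_integral_norm _).trans_eq ?_
    simp only [norm_mul, norm_cexp_I_mul_mul, mul_one]
  have iA : ∀ x n, IntegrableOn (fun t => a t * K (x - t) * e n t) (Set.Ioi 0) := fun x n => by
    have h1 := (hint (1 / (n + 1 : ℝ)) (by positivity)).mul_bdd (c := B)
      (g := fun t => K (x - t)) (Continuous.aestronglyMeasurable (by fun_prop))
      (Eventually.of_forall fun t => hB _)
    refine h1.congr (Eventually.of_forall fun t => ?_)
    simp only [e]; ring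
  have hid : ∀ x n, ∫ t in Set.Ioi (0 : ℝ), a t * K (x - t) * e n t =
      (∫ t in Set.Ioi (0 : ℝ), A * K (x - t) * e n t) +
      (∫ y : ℝ, k y * Complex.exp (Complex.I * y * x) *
        H (((1 / (n + 1 : ℝ) : ℝ) : ℂ) + Complex.I * y)).re := fun x n => by
    rw [← integral_sub_const_mul_exp_mul_kernel hint hLap hk hkc hK
      (by positivity : (0 : ℝ) < 1 / (n + 1 : ℝ)) x, Complex.ofReal_re,
      ← integral_add ((dom _ (hK1 x)).1 n)]
    · refine integral_congr_ae (Eventually.of_forall fun t => ?_)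
      simp only [e]; ring
    · refine ((iA x n).sub ((dom _ (hK1 x)).1 n)).congr (Eventually.of_forall fun t => ?_)
      simp only [e, Pi.sub_apply]; ring
  have hlimA : ∀ x, Tendsto (fun n => ∫ t in Set.Ioi (0 : ℝ), a t * K (x - t) * e n t) atTop
      (𝓝 ((∫ t in Set.Ioi (0 : ℝ), A * K (x - t)) + (R x).re)) := fun x => by
    simp_rw [hid]
    exact (dom _ (hK1 x)).2.add ((Complex.continuous_re.tendsto _).comp
      (tendsto_integral_kernel_mul_boundary hH hk hkc x))
  -- The damped integrands are nonnegative and their integrals converge, so Fatou's lemma gives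
  -- integrability without damping.
  have iK : ∀ x, IntegrableOn (fun t => a t * K (x - t)) (Set.Ioi 0) := fun x => by
    have hnn : ∀ n t, 0 ≤ a t * K (x - t) * e n t := fun n t =>
      mul_nonneg (mul_nonneg (ha0 t) (hK0 _)) (he0 n t)
    refine integrable_of_tendsto (G := fun n t => a t * K (x - t) * e n t)
      (Eventually.of_forall fun t => by simpa using (hlim t).const_mul (a t * K (x - t)))
      (fun n => (iA x n).1) ?_
    have : (fun n => ∫⁻ t in Set.Ioi (0 : ℝ), ‖a t * K (x - t) * e n t‖ₑ) =
        fun n => ENNReal.ofReal (∫ t in Set.Ioi (0 : ℝ), a t * K (x - t) * e n t) := by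
      ext n
      rw [← ofReal_integral_norm_eq_lintegral_enorm (iA x n)]
      simp only [Real.norm_of_nonneg (hnn n _)]
    rw [this, (ENNReal.tendsto_ofReal (hlimA x)).liminf_eq]
    exact ENNReal.ofReal_ne_top
  have hval : ∀ x, ∫ t in Set.Ioi (0 : ℝ), a t * K (x - t) =
      (∫ t in Set.Ioi (0 : ℝ), A * K (x - t)) + (R x).re := fun x =>
    tendsto_nhds_unique (dom _ (iK x)).2 (hlimA x)
  refine ⟨iK, ?_⟩
  simp_rw [hval]
  have hR : Tendsto (fun x => (R x).re) atTop (𝓝 0) := by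
    have := (Complex.continuous_re.tendsto 0).comp
      (tendsto_integral_kernel_mul_boundary_atTop fun y => k y * H (Complex.I * y))
    refine this.congr fun x => ?_
    simp only [Function.comp, R]
    congr 2
    ext y
    ring
  have hKx : ∀ x, ∫ t in Set.Ioi (0 : ℝ), A * K (x - t) = A * ∫ v in Set.Iio x, K v := fun x => by
    rw [integral_const_mul]
    congr 1
    rw [← integral_indicator measurableSet_Ioi, ← integral_indicator measurableSet_Iio,
      ← integral_sub_left_eq_self _ volume x]
    refine integral_congr_ae (Eventually.of_forall fun t => ?_)
    simp only [Set.indicator, Set.mem_Ioi, Set.mem_Iio, sub_sub_cancel, sub_pos]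
  simp_rw [hKx]
  have : Tendsto (fun x => ∫ v in Set.Iio x, K v) atTop (𝓝 (∫ v, K v)) := by
    simp_rw [← integral_Iic_eq_integral_Iio]
    have := tendsto_setIntegral_of_monotone (μ := volume) (f := K) (s := fun x : ℝ => Set.Iic x)
      (fun x => measurableSet_Iic) (fun _ _ h => Set.Iic_subset_Iic.mpr h) hKi.integrableOn
    simpa [Set.iUnion_Iic] using this
  simpa using (this.const_mul A).add hR

end BandlimitedKernel

/-! ### From averages to pointwise values: the Wiener–Ikehara theorem. -/

/-- The integrand is nonnegative, so everything outside the window around c may be discarded. -/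
lemma mul_setIntegral_le_integral_mul_kernel {a K : ℝ → ℝ} {c δ m : ℝ} (ha0 : ∀ t, 0 ≤ a t)
    (hK0 : ∀ v, 0 ≤ K v) (hKi : Integrable K)
    (hi : IntegrableOn (fun t => a t * K (c - t)) (Set.Ioi 0))
    (hm : ∀ t, c - t ∈ Set.Icc (-δ) δ → 0 < t ∧ m ≤ a t) :
    m * ∫ v in Set.Icc (-δ) δ, K v ≤ ∫ t in Set.Ioi (0 : ℝ), a t * K (c - t) := by
  have hκ : Integrable ((Set.Icc (-δ) δ).indicator K) := hKi.indicator measurableSet_Icc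
  rw [← integral_indicator measurableSet_Icc, ← integral_indicator measurableSet_Ioi,
    ← integral_sub_left_eq_self ((Set.Icc (-δ) δ).indicator K) volume c, ← integral_const_mul]
  refine integral_mono ((hκ.comp_sub_left c).const_mul m)
    ((integrable_indicator_iff measurableSet_Ioi).mpr hi) fun t => ?_
  have h0 : 0 ≤ (Set.Ioi (0 : ℝ)).indicator (fun t => a t * K (c - t)) t :=
    Set.indicator_nonneg (fun t _ => mul_nonneg (ha0 t) (hK0 _)) t
  by_cases h : c - t ∈ Set.Icc (-δ) δ
  · obtain ⟨h1, h2⟩ := hm t h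
    simp only [Set.indicator_of_mem h, Set.indicator_of_mem (Set.mem_Ioi.mpr h1)]
    exact mul_le_mul_of_nonneg_right h2 (hK0 _)
  · simpa only [Set.indicator_of_notMem h, mul_zero] using h0

/-- Here the tail of K cannot be discarded: its mass is charged at the global bound B. -/
lemma integral_mul_kernel_le {a K : ℝ → ℝ} {c δ m B : ℝ} (hm0 : 0 ≤ m) (hB0 : 0 ≤ B)
    (hK0 : ∀ v, 0 ≤ K v) (hKi : Integrable K)
    (hi : IntegrableOn (fun t => a t * K (c - t)) (Set.Ioi 0))
    (hB : ∀ t, 0 < t → a t ≤ B) (hm : ∀ t, c - t ∈ Set.Icc (-δ) δ → a t ≤ m) :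
    ∫ t in Set.Ioi (0 : ℝ), a t * K (c - t) ≤
      m * (∫ v in Set.Icc (-δ) δ, K v) + B * ((∫ v, K v) - ∫ v in Set.Icc (-δ) δ, K v) := by
  set κ := (Set.Icc (-δ) δ).indicator K with hκdef
  have hκ : Integrable κ := hKi.indicator measurableSet_Icc
  have hd : Integrable fun v => B * (K v - κ v) := (hKi.sub hκ).const_mul B
  rw [← integral_indicator measurableSet_Icc, ← integral_indicator measurableSet_Ioi,
    ← hκdef, ← integral_sub hKi hκ, ← integral_const_mul, ← integral_const_mul,
    ← integral_add (hκ.const_mul m) hd,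
    ← integral_sub_left_eq_self (fun v => m * κ v + B * (K v - κ v)) volume c]
  refine integral_mono ((integrable_indicator_iff measurableSet_Ioi).mpr hi)
    (((hκ.const_mul m).add hd).comp_sub_left c) fun t => ?_
  have h0 : 0 ≤ m * κ (c - t) + B * (K (c - t) - κ (c - t)) := by
    have h1 : 0 ≤ κ (c - t) := Set.indicator_nonneg (fun v _ => hK0 v) _
    have h2 : κ (c - t) ≤ K (c - t) := Set.indicator_le_self' (fun v _ => hK0 v) _
    have := sub_nonneg.mpr h2
    positivity
  by_cases ht : t ∈ Set.Ioi (0 : ℝ)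
  · simp only [Set.indicator_of_mem ht]
    by_cases h : c - t ∈ Set.Icc (-δ) δ
    · simp only [hκdef, Set.indicator_of_mem h, sub_self, mul_zero, add_zero]
      exact mul_le_mul_of_nonneg_right (hm t h) (hK0 _)
    · simp only [hκdef, Set.indicator_of_notMem h, sub_zero, mul_zero, zero_add]
      exact mul_le_mul_of_nonneg_right (hB t ht) (hK0 _)
  · simpa only [Set.indicator_of_notMem ht] using h0

/-- The **Wiener–Ikehara theorem** for a monotone function whose Laplace transform has a simple
pole at `1`. -/
theorem wiener_ikehara {f : ℝ → ℝ} {A : ℝ} {H : ℂ → ℂ} (hf : Monotone f) (hf0 : ∀ t, 0 ≤ f t)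
    (hint : ∀ ε : ℝ, 0 < ε →
      IntegrableOn (fun t => f t * Real.exp (-t) * Real.exp (-(ε * t))) (Set.Ioi 0))
    (hH : ContinuousOn H {z | 0 ≤ z.re})
    (hLap : ∀ z : ℂ, 0 < z.re →
      ∫ t in Set.Ioi (0 : ℝ), ((f t * Real.exp (-t) : ℝ) : ℂ) * Complex.exp (-(z * t)) =
        H z + A / z) :
    Tendsto (fun t => f t * Real.exp (-t)) atTop (𝓝 A) := by
  set a : ℝ → ℝ := fun t => f t * Real.exp (-t) with ha
  have ha0 : ∀ t, 0 ≤ a t := fun t => mul_nonneg (hf0 t) (Real.exp_pos _).le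
  -- As f increases, a can only fall through e^{-t}, by at most a factor e^{-d} over length d.
  have hshift : ∀ {s t d : ℝ}, s ≤ t → t ≤ s + d → a s * Real.exp (-d) ≤ a t := by
    intro s t d hst htd
    simp only [ha, mul_assoc, ← Real.exp_add]
    exact mul_le_mul (hf hst) (Real.exp_le_exp.mpr (by linarith)) (Real.exp_pos _).le (hf0 t)
  have hkernel : ∀ δ : ℝ, 0 < δ → ∃ K : ℝ → ℝ, (∀ v, 0 ≤ K v) ∧ Integrable K ∧
      ∫ v, K v = 1 ∧ 1 - δ < ∫ v in Set.Icc (-δ) δ, K v ∧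
      (∀ x, IntegrableOn (fun t => a t * K (x - t)) (Set.Ioi 0)) ∧
      Tendsto (fun x => ∫ t in Set.Ioi (0 : ℝ), a t * K (x - t)) atTop (𝓝 A) := by
    intro δ hδ
    obtain ⟨k, K, hk, hkc, hK, hK0, hKc, hKi, hK1, hKδ⟩ := exists_bandlimited_kernel hδ hδ
    obtain ⟨h1, h2⟩ := tendsto_integral_mul_kernel ha0 hint hH hLap hk hkc hK hK0 hKc hKi
    exact ⟨K, hK0, hKi, hK1, hKδ, h1, by simpa [hK1] using h2⟩
  have hupper : ∀ A' > A, ∀ᶠ x in atTop, a x < A' := by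
    intro A' hA'
    have hc : ContinuousAt (fun δ : ℝ => (A + δ) * Real.exp (2 * δ) / (1 - δ)) 0 :=
      ContinuousAt.div (by fun_prop) (by fun_prop) (by norm_num)
    have hsmall : ∀ᶠ δ in 𝓝[>] (0 : ℝ), (A + δ) * Real.exp (2 * δ) / (1 - δ) < A' :=
      nhdsWithin_le_nhds (hc.eventually_lt continuousAt_const (by simpa using hA'))
    obtain ⟨δ, hδA, hδ⟩ := (hsmall.and (Ioo_mem_nhdsGT (zero_lt_one (α := ℝ)))).exists
    obtain ⟨K, hK0, hKi, hK1, hKδ, hi, hT⟩ := hkernel δ hδ.1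
    -- Centring the kernel at x + δ puts the window at [x, x + 2δ], where a ≥ a(x) e^{-2δ}.
    have hT' := hT.comp (tendsto_atTop_add_const_right atTop δ tendsto_id)
    filter_upwards [hT'.eventually_lt_const (by linarith [hδ.1] : A < A + δ),
      eventually_gt_atTop 0] with x hx hx0
    refine lt_of_le_of_lt ?_ hδA
    have h1 := mul_setIntegral_le_integral_mul_kernel (c := x + δ) (δ := δ)
      (m := a x * Real.exp (-(2 * δ))) ha0 hK0 hKi (hi _) fun t ht => by
        obtain ⟨h1, h2⟩ := ht
        exact ⟨by linarith, hshift (by linarith) (by linarith)⟩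
    have h2 : a x * Real.exp (-(2 * δ)) * (1 - δ) ≤ A + δ :=
      (mul_le_mul_of_nonneg_left hKδ.le (mul_nonneg (ha0 x) (Real.exp_pos _).le)).trans
        (h1.trans hx.le)
    rw [le_div_iff₀ (by linarith [hδ.2])]
    rw [Real.exp_neg] at h2
    have := Real.exp_pos (2 * δ)
    calc a x * (1 - δ) = a x * (Real.exp (2 * δ))⁻¹ * (1 - δ) * Real.exp (2 * δ) := by field_simp
      _ ≤ _ := mul_le_mul_of_nonneg_right h2 this.le
  -- The upper bound controls a for large t and monotonicity of f controls the rest; the lower bound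
  -- needs this B for the kernel's tail.
  obtain ⟨B, hB0, hB⟩ : ∃ B, 0 ≤ B ∧ ∀ t, 0 < t → a t ≤ B := by
    obtain ⟨t₀, ht₀⟩ := eventually_atTop.mp (hupper (A + 1) (by linarith))
    refine ⟨max (f t₀) (A + 1), le_max_of_le_left (hf0 _), fun t ht => ?_⟩
    rcases le_total t t₀ with h | h
    · refine le_max_of_le_left ((mul_le_of_le_one_right (hf0 t) ?_).trans (hf h))
      exact Real.exp_le_one_iff.mpr (by linarith)
    · exact le_max_of_le_right (ht₀ t h).le
  have hlower : ∀ A' < A, ∀ᶠ x in atTop, A' < a x := by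
    intro A' hA'
    have hc : ContinuousAt (fun δ : ℝ => (A - δ - B * δ) * Real.exp (-(2 * δ))) 0 := by fun_prop
    have hsmall : ∀ᶠ δ in 𝓝[>] (0 : ℝ), A' < (A - δ - B * δ) * Real.exp (-(2 * δ)) :=
      nhdsWithin_le_nhds (continuousAt_const.eventually_lt hc (by simpa using hA'))
    obtain ⟨δ, hδA, hδ⟩ := (hsmall.and (Ioo_mem_nhdsGT (zero_lt_one (α := ℝ)))).exists
    obtain ⟨K, hK0, hKi, hK1, hKδ, hi, hT⟩ := hkernel δ hδ.1
    -- Now the window is [x - 2δ, x], where a ≤ a(x) e^{2δ}.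
    have hT' := hT.comp (tendsto_atTop_add_const_right atTop (-δ) tendsto_id)
    filter_upwards [hT'.eventually_const_lt (by linarith [hδ.1] : A - δ < A)] with x hx
    refine lt_of_lt_of_le hδA ?_
    have hm0 : 0 ≤ a x * Real.exp (2 * δ) := mul_nonneg (ha0 x) (Real.exp_pos _).le
    have h1 := integral_mul_kernel_le (c := x + -δ) (δ := δ) hm0 hB0 hK0 hKi (hi _) hB
      fun t ht => by
        obtain ⟨h1, h2⟩ := ht
        have h3 := hshift (s := t) (t := x) (d := 2 * δ) (by linarith) (by linarith)
        rw [Real.exp_neg, ← div_eq_mul_inv, div_le_iff₀ (Real.exp_pos _)] at h3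
        exact h3
    have h2 : ∫ v in Set.Icc (-δ) δ, K v ≤ 1 :=
      hK1 ▸ setIntegral_le_integral hKi (Eventually.of_forall hK0)
    have h3 : A - δ < ∫ t in Set.Ioi (0 : ℝ), a t * K (x + -δ - t) := hx
    rw [hK1] at h1
    have h4 := mul_le_mul_of_nonneg_left h2 hm0
    have h5 : B * (1 - ∫ v in Set.Icc (-δ) δ, K v) ≤ B * δ :=
      mul_le_mul_of_nonneg_left (by linarith) hB0
    rw [Real.exp_neg, ← div_eq_mul_inv, div_le_iff₀ (Real.exp_pos _)]
    linarith
  exact tendsto_order.mpr ⟨hlower, hupper⟩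

/-! ### Complex-analytic and Laplace transform tools. -/

/-- Removing the simple pole at the origin from a geometric series of transforms. -/
lemma exists_continuousOn_eq_add_pole {Φ : ℂ → ℂ} {μ : ℝ} (hμ : μ ≠ 0)
    (hΦ : DifferentiableOn ℂ Φ {z | -1 < z.re}) (h0 : Φ 0 = 1) (hd : deriv Φ 0 = -μ)
    (hne : ∀ z : ℂ, 0 ≤ z.re → z ≠ 0 → Φ z ≠ 1) :
    ∃ H : ℂ → ℂ, ContinuousOn H {z | 0 ≤ z.re} ∧ ∀ z : ℂ, 0 < z.re →
      Φ z / (1 - Φ z) / (1 + z) = H z + (μ⁻¹ : ℝ) / z := by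
  set S : Set ℂ := {z | -1 < z.re}
  have hSo : IsOpen S := isOpen_lt continuous_const Complex.continuous_re
  have h0S : (0 : ℂ) ∈ S := by simp [S]
  -- q is (Φ - 1)/z with its singularity at 0 filled in by -μ; it has no zero on the closed
  -- half-plane.
  set q := dslope Φ 0 with hq
  have hqd : DifferentiableOn ℂ q S :=
    (Complex.differentiableOn_dslope (hSo.mem_nhds h0S)).mpr hΦ
  have hq0 : q 0 = -μ := by rw [hq, dslope_same, hd]
  have hqz : ∀ z, z * q z = Φ z - 1 := fun z => by
    simpa [h0] using sub_smul_dslope Φ 0 z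
  have hqne : ∀ z : ℂ, 0 ≤ z.re → q z ≠ 0 := fun z hz h => by
    rcases eq_or_ne z 0 with rfl | hz0
    · rw [hq0] at h
      exact hμ (by exact_mod_cast neg_eq_zero.mp h)
    · have := hqz z
      rw [h, mul_zero] at this
      exact hne z hz hz0 (sub_eq_zero.mp this.symm)
  set T : Set ℂ := S ∩ q ⁻¹' {0}ᶜ
  have hTo : IsOpen T := hqd.continuousOn.isOpen_inter_preimage hSo isOpen_compl_singleton
  have hT : ∀ z : ℂ, 0 ≤ z.re → z ∈ T := fun z hz =>
    ⟨show -1 < z.re by linarith, hqne z hz⟩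
  have h1z : ∀ z ∈ S, 1 + z ≠ 0 := fun z hz h => by
    have h1 : -1 < z.re := hz
    have h2 := congrArg Complex.re h
    simp at h2
    linarith
  -- r is z times the left-hand side, so subtracting the pole r(0)/z leaves the difference quotient
  -- of r at 0, which serves as H.
  set r : ℂ → ℂ := fun z => -Φ z / ((1 + z) * q z) with hr
  have hrd : DifferentiableOn ℂ r T :=
    (hΦ.mono Set.inter_subset_left).neg.div
      (((differentiableOn_const 1).add differentiableOn_id).mul (hqd.mono Set.inter_subset_left))
      fun z hz => mul_ne_zero (h1z z hz.1) hz.2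
  have hr0 : r 0 = (μ⁻¹ : ℝ) := by
    simp [hr, h0, hq0, neg_div_neg_eq]
  refine ⟨dslope r 0, ?_, fun z hz => ?_⟩
  · exact ((Complex.differentiableOn_dslope (hTo.mem_nhds (hT 0 (by simp)))).mpr
      hrd).continuousOn.mono fun z hz => hT z hz
  · have hz0 : z ≠ 0 := fun h => by simp [h] at hz
    have hz1 := h1z z (hT z hz.le).1
    have hqn := hqne z hz.le
    have e1 : 1 - Φ z = -(z * q z) := by rw [hqz]; ring
    rw [dslope_of_ne _ hz0, slope_def_field, sub_zero, hr0, ← add_div, sub_add_cancel, e1]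
    simp only [hr]
    field_simp

/-- The Laplace transform of a distribution function. -/
lemma integral_measureReal_Iic_mul_exp {κ : Measure ℝ} [IsProbabilityMeasure κ]
    (h0 : ∀ᵐ y ∂κ, 0 ≤ y) {z : ℂ} (hz : 0 < z.re) :
    IntegrableOn (fun t : ℝ => (κ.real (Set.Iic t) : ℂ) * Complex.exp (-(z * t))) (Set.Ioi 0) ∧
    ∫ t in Set.Ioi (0 : ℝ), (κ.real (Set.Iic t) : ℂ) * Complex.exp (-(z * t)) =
      (∫ y, Complex.exp (-(z * y)) ∂κ) / z := by
  -- Fubini on the region y ≤ t: integrating out y gives the distribution function, integrating out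
  -- t gives exp(-zy)/z.
  set G : ℝ × ℝ → ℂ := {p : ℝ × ℝ | p.2 ≤ p.1}.indicator fun p => Complex.exp (-(z * p.1)) with hG
  have hz' : (-z).re < 0 := by simpa using hz
  have hi : IntegrableOn (fun t : ℝ => Complex.exp (-(z * t))) (Set.Ioi 0) := by
    have := integrableOn_exp_mul_complex_Ioi hz' 0
    simp_rw [neg_mul] at this
    exact this
  have hGi : Integrable G ((volume.restrict (Set.Ioi 0)).prod κ) :=
    (Integrable.comp_fst (f := fun t : ℝ => Complex.exp (-(z * t))) hi κ).indicator
      (measurableSet_le measurable_snd measurable_fst)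
  have e1 : ∀ t : ℝ, ∫ y, G (t, y) ∂κ = (κ.real (Set.Iic t) : ℂ) * Complex.exp (-(z * t)) := by
    intro t
    have : (fun y => G (t, y)) = (Set.Iic t).indicator fun _ => Complex.exp (-(z * t)) := by
      ext y
      simp [hG, Set.indicator]
    rw [this, integral_indicator_const _ measurableSet_Iic, Complex.real_smul]
  have e2 : ∀ y : ℝ, 0 ≤ y →
      ∫ t in Set.Ioi (0 : ℝ), G (t, y) = Complex.exp (-(z * y)) / z := by
    intro y hy
    have : (fun t => G (t, y)) = (Set.Ici y).indicator fun t => Complex.exp (-(z * t)) := by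
      ext t
      simp [hG, Set.indicator]
    rw [this, ← integral_Ici_eq_integral_Ioi, setIntegral_indicator measurableSet_Ici,
      Set.inter_eq_right.mpr (Set.Ici_subset_Ici.mpr hy), integral_Ici_eq_integral_Ioi]
    have := integral_exp_mul_complex_Ioi hz' y
    simp_rw [neg_mul] at this
    rw [this, neg_div_neg_eq]
  refine ⟨hGi.integral_prod_left.congr (Eventually.of_forall e1), ?_⟩
  simp_rw [← e1]
  rw [integral_integral_swap (f := fun t y => G (t, y)) hGi, ← integral_div]
  refine integral_congr_ae ?_
  filter_upwards [h0] with y hy using e2 y hy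

lemma integral_pos_of_ae_pos {Ω : Type*} [MeasurableSpace Ω] {P : Measure Ω}
    [IsProbabilityMeasure P] {f : Ω → ℝ} (hi : Integrable f P) (hf : ∀ᵐ ω ∂P, 0 < f ω) :
    0 < ∫ ω, f ω ∂P := by
  rw [integral_pos_iff_support_of_nonneg_ae (hf.mono fun _ h => h.le) hi]
  have : (Function.support f) =ᵐ[P] Set.univ := by
    filter_upwards [hf] with ω h
    exact eq_true h.ne'
  rw [measure_congr this]
  simp

/-! ### The transform E V^z as the moment generating function of log V. -/

section LogTransform

variable {Ω : Type*} [MeasurableSpace Ω] {P : Measure Ω} [IsProbabilityMeasure P] {V : Ω → ℝ}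

lemma integrable_exp_mul_log (hVm : AEMeasurable V P) (hV : ∀ᵐ ω ∂P, V ω ∈ Set.Ioo 0 1)
    {s : ℝ} (hs : 0 ≤ s) : Integrable (fun ω => Real.exp (s * Real.log (V ω))) P := by
  refine Integrable.of_bound (C := 1)
    ((Real.measurable_log.comp_aemeasurable hVm).const_mul s).exp.aestronglyMeasurable ?_
  filter_upwards [hV] with ω h
  rw [Real.norm_of_nonneg (Real.exp_pos _).le]
  exact Real.exp_le_one_iff.mpr (mul_nonpos_of_nonneg_of_nonpos hs (Real.log_neg h.1 h.2).le)

omit [IsProbabilityMeasure P] in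
lemma mgf_log_one (hV : ∀ᵐ ω ∂P, V ω ∈ Set.Ioo 0 1) :
    mgf (fun ω => Real.log (V ω)) P 1 = ∫ ω, V ω ∂P := by
  refine integral_congr_ae ?_
  filter_upwards [hV] with ω h
  rw [one_mul, Real.exp_log h.1]

/-- V^s < V almost surely, since 0 < V < 1 and s > 1. -/
lemma mgf_log_lt (hVm : AEMeasurable V P) (hV : ∀ᵐ ω ∂P, V ω ∈ Set.Ioo 0 1) {s : ℝ}
    (hs : 1 < s) : mgf (fun ω => Real.log (V ω)) P s < mgf (fun ω => Real.log (V ω)) P 1 := by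
  have h1 := integrable_exp_mul_log hVm hV zero_le_one
  have h2 := integrable_exp_mul_log hVm hV (zero_le_one.trans hs.le)
  have := integral_pos_of_ae_pos (h1.sub h2) (by
    filter_upwards [hV] with ω h
    refine sub_pos.mpr (Real.exp_lt_exp.mpr ?_)
    have := Real.log_neg h.1 h.2
    nlinarith)
  rw [integral_sub' h1 h2] at this
  exact sub_pos.mp this

lemma mem_interior_integrableExpSet_log (hVm : AEMeasurable V P)
    (hV : ∀ᵐ ω ∂P, V ω ∈ Set.Ioo 0 1) {s : ℝ} (hs : 0 < s) :
    s ∈ interior (integrableExpSet (fun ω => Real.log (V ω)) P) :=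
  mem_interior.mpr ⟨Set.Ioi 0, fun _ hu => integrable_exp_mul_log hVm hV (le_of_lt hu),
    isOpen_Ioi, hs⟩

lemma hasDerivAt_complexMGF_log_one (hVm : AEMeasurable V P)
    (hV : ∀ᵐ ω ∂P, V ω ∈ Set.Ioo 0 1) :
    HasDerivAt (complexMGF (fun ω => Real.log (V ω)) P)
      ((-∫ ω, V ω * -Real.log (V ω) ∂P : ℝ) : ℂ) 1 := by
  have h := hasDerivAt_complexMGF (X := fun ω => Real.log (V ω)) (μ := P) (z := 1)
    (mem_interior_integrableExpSet_log hVm hV (by simp))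
  convert h using 1
  rw [← integral_neg, ← integral_complex_ofReal]
  refine integral_congr_ae ?_
  filter_upwards [hV] with ω h
  rw [one_mul, ← Complex.ofReal_exp, Real.exp_log h.1]
  push_cast
  ring

/-- A non-lattice law has no period on the critical line. -/
lemma complexMGF_log_one_add_I_mul_ne (hVm : AEMeasurable V P)
    (hV : ∀ᵐ ω ∂P, V ω ∈ Set.Ioo 0 1)
    (hlat : ¬ SplitTree.IsLattice P fun ω => -Real.log (V ω)) {y : ℝ} (hy : y ≠ 0) :
    complexMGF (fun ω => Real.log (V ω)) P (1 + Complex.I * y) ≠ ((∫ ω, V ω ∂P : ℝ) : ℂ) := by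
  intro h
  apply hlat
  have hLm : AEMeasurable (fun ω => Real.log (V ω)) P := Real.measurable_log.comp_aemeasurable hVm
  have hVi : Integrable V P := by
    refine (integrable_exp_mul_log hVm hV zero_le_one).congr ?_
    filter_upwards [hV] with ω h
    rw [one_mul, Real.exp_log h.1]
  have hint : Integrable (fun ω => Complex.exp ((1 + Complex.I * y) * (Real.log (V ω) : ℝ))) P := by
    refine Integrable.of_bound (C := 1) ?_ ?_
    · exact (Complex.measurable_exp.comp_aemeasurable
        ((Complex.measurable_ofReal.comp_aemeasurable hLm).const_mul _)).aestronglyMeasurable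
    · filter_upwards [hV] with ω h
      rw [Complex.norm_exp]
      simpa using (Real.log_neg h.1 h.2).le
  have hre : (fun ω => (Complex.exp ((1 + Complex.I * y) * (Real.log (V ω) : ℝ))).re) =ᵐ[P]
      fun ω => V ω * Real.cos (y * Real.log (V ω)) := by
    filter_upwards [hV] with ω h
    rw [Complex.exp_re]
    simp [Real.exp_log h.1]
  have h1 : ∫ ω, V ω * Real.cos (y * Real.log (V ω)) ∂P = ∫ ω, V ω ∂P := by
    rw [← integral_congr_ae hre]
    have := congrArg Complex.re h
    rw [Complex.ofReal_re, complexMGF] at this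
    rw [← this]
    exact integral_re hint
  have hi2 : Integrable (fun ω => V ω * Real.cos (y * Real.log (V ω))) P :=
    (hint.re).congr hre
  -- Equality of real parts makes the nonnegative variable V (1 - cos(y log V)) have mean zero, so
  -- it vanishes almost surely and the span is 2π/|y|.
  have h2 : ∫ ω, (V ω - V ω * Real.cos (y * Real.log (V ω))) ∂P = 0 := by
    rw [integral_sub hVi hi2, h1, sub_self]
  have hi3 : Integrable (fun ω => V ω - V ω * Real.cos (y * Real.log (V ω))) P := hVi.sub hi2
  rw [integral_eq_zero_iff_of_nonneg_ae ?_ hi3] at h2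
  · refine ⟨2 * Real.pi / |y|, by positivity, ?_⟩
    filter_upwards [h2, hV] with ω h2 h
    have h3 : Real.cos (y * Real.log (V ω)) = 1 := by
      have h4 : V ω * (1 - Real.cos (y * Real.log (V ω))) = 0 := by
        simpa [mul_sub] using h2
      rcases mul_eq_zero.mp h4 with h5 | h5
      · exact absurd h5 h.1.ne'
      · linarith
    have hcos : Real.cos (|y| * -Real.log (V ω)) = 1 := by
      rw [mul_neg, Real.cos_neg]
      rcases abs_cases y with hc | hc <;> rw [hc.1]
      · exact h3
      · rw [neg_mul, Real.cos_neg, h3]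
    obtain ⟨n, hn⟩ := (Real.cos_eq_one_iff _).mp hcos
    refine ⟨n, ?_⟩
    have : |y| ≠ 0 := abs_ne_zero.mpr hy
    field_simp
    linarith
  · filter_upwards [hV] with ω h
    have := Real.cos_le_one (y * Real.log (V ω))
    have := h.1
    simp only [Pi.zero_apply]
    nlinarith

end LogTransform

/-! ### Split vectors and the size-biased law. -/

section SplitVector

variable {Ω₀ : Type*} [MeasurableSpace Ω₀] {P₀ : Measure Ω₀} [IsProbabilityMeasure P₀]
  {Ω : Type*} [MeasurableSpace Ω] {P : Measure Ω} {b : ℕ} {S : Ω₀ → Fin b → ℝ} {V : Ω → ℝ}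

lemma SplitTree.IsSplitVector.pos (hS : SplitTree.IsSplitVector P₀ S) : 0 < b := by
  rcases Nat.eq_zero_or_pos b with rfl | h
  · obtain ⟨ω, hω⟩ := hS.sum_eq_one.exists
    simp at hω
  · exact h

omit [IsProbabilityMeasure P₀] in
lemma SplitTree.IsSplitVector.mem_Icc (hS : SplitTree.IsSplitVector P₀ S) (i : Fin b) :
    ∀ᵐ ω ∂P₀, S ω i ∈ Set.Icc 0 1 := by
  filter_upwards [hS.nonneg, hS.sum_eq_one] with ω h0 h1
  exact ⟨h0 i, h1 ▸ Finset.single_le_sum (fun j _ => h0 j) (Finset.mem_univ i)⟩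

/-- Taking expectations in ∑ S_i = 1 gives this; it is what places the pole of the transform at 1.
-/
lemma SplitTree.IsSplitVector.mul_integral_eq_one (hS : SplitTree.IsSplitVector P₀ S)
    (hV : ∀ i, IdentDistrib V (fun ω => S ω i) P P₀) : (b : ℝ) * ∫ ω, V ω ∂P = 1 := by
  have hi : ∀ i, Integrable (fun ω => S ω i) P₀ := fun i => by
    refine Integrable.of_bound (C := 1)
      ((measurable_pi_apply i).comp hS.measurable).aestronglyMeasurable ?_
    filter_upwards [hS.mem_Icc i] with ω h
    rw [Real.norm_of_nonneg h.1]
    exact h.2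
  have h1 : ∫ ω, ∑ i, S ω i ∂P₀ = 1 := by
    rw [integral_congr_ae hS.sum_eq_one]
    simp
  rw [integral_finsetSum _ fun i _ => hi i] at h1
  simp_rw [← fun i => (hV i).integral_eq] at h1
  simpa using h1

lemma SplitTree.IsSplitVector.ae_mem_Ioo (hS : SplitTree.IsSplitVector P₀ S)
    (hV : ∀ i, IdentDistrib V (fun ω => S ω i) P P₀)
    (hV_one : ∀ᵐ ω ∂P, V ω ≠ 1) (hV_zero : ∀ᵐ ω ∂P, V ω ≠ 0) :
    ∀ᵐ ω ∂P, V ω ∈ Set.Ioo 0 1 := by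
  have h := (hV ⟨0, hS.pos⟩).symm.ae_snd (p := fun x => x ∈ Set.Icc (0 : ℝ) 1)
    measurableSet_Icc (hS.mem_Icc ⟨0, hS.pos⟩)
  filter_upwards [h, hV_one, hV_zero] with ω h h1 h0
  exact ⟨lt_of_le_of_ne h.1 (Ne.symm h0), lt_of_le_of_ne h.2 h1⟩

omit [IsProbabilityMeasure P₀] in
lemma SplitTree.IsSplitVector.integral_sizeBiasedLaw (hS : SplitTree.IsSplitVector P₀ S)
    (hV : ∀ i, IdentDistrib V (fun ω => S ω i) P P₀) {f : ℝ → ℝ} (hf : Measurable f)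
    (hfi : Integrable (fun ω => V ω * f (V ω)) P) :
    Integrable f (SplitTree.sizeBiasedLaw P₀ S) ∧
      ∫ x, f x ∂SplitTree.sizeBiasedLaw P₀ S = b * ∫ ω, V ω * f (V ω) ∂P := by
  have hSm : ∀ j, Measurable fun ω => S ω j := fun j =>
    (measurable_pi_apply j).comp hS.measurable
  have hid : ∀ j, IdentDistrib (fun ω => V ω * f (V ω)) (fun ω => S ω j * f (S ω j)) P P₀ :=
    fun j => (hV j).comp (u := fun x => x * f x) (measurable_id.mul hf)
  have hsmul : ∀ j, (fun ω => (ENNReal.ofReal (S ω j)).toReal • f (S ω j)) =ᵐ[P₀]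
      fun ω => S ω j * f (S ω j) := fun j => by
    filter_upwards [hS.nonneg] with ω h
    rw [ENNReal.toReal_ofReal (h j), smul_eq_mul]
  have hi : ∀ j ∈ Finset.univ, Integrable f
      ((P₀.withDensity (fun ω => ENNReal.ofReal (S ω j))).map (fun ω => S ω j)) := fun j _ => by
    rw [integrable_map_measure hf.aestronglyMeasurable (hSm j).aemeasurable,
      integrable_withDensity_iff_integrable_smul' (hSm j).ennreal_ofReal (by simp)]
    exact ((hid j).integrable_iff.mp hfi).congr (hsmul j).symm
  refine ⟨integrable_finsetSum_measure.mpr hi, ?_⟩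
  rw [SplitTree.sizeBiasedLaw, integral_finsetSum_measure hi]
  have : ∀ j, ∫ x, f x ∂((P₀.withDensity (fun ω => ENNReal.ofReal (S ω j))).map
      (fun ω => S ω j)) = ∫ ω, V ω * f (V ω) ∂P := fun j => by
    rw [integral_map (hSm j).aemeasurable hf.aestronglyMeasurable,
      integral_withDensity_eq_integral_toReal_smul (hSm j).ennreal_ofReal (by simp),
      integral_congr_ae (hsmul j), (hid j).integral_eq]
  simp [this]

end SplitVector

/-! ### The walk Y_k and the summands ν_k. -/

section Walk

variable {Ω : Type*} [MeasurableSpace Ω] {P : Measure Ω} [IsProbabilityMeasure P]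
  {V : Ω → ℝ} {W : ℕ → Ω → ℝ}

omit [IsProbabilityMeasure P] in
lemma aemeasurable_Y (hW : ∀ j, AEMeasurable (W j) P) (k : ℕ) :
    AEMeasurable (SplitTree.Y W k) P :=
  (Finset.aemeasurable_fun_sum _ fun j _ => Real.measurable_log.comp_aemeasurable (hW j)).neg

omit [IsProbabilityMeasure P] in
lemma ae_nonneg_Y (hW : ∀ j, ∀ᵐ ω ∂P, W j ω ∈ Set.Ioo 0 1) (k : ℕ) :
    ∀ᵐ ω ∂P, 0 ≤ SplitTree.Y W k ω := by
  filter_upwards [ae_all_iff.mpr hW] with ω h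
  exact neg_nonneg.mpr (Finset.sum_nonpos fun j _ => (Real.log_neg (h j).1 (h j).2).le)

omit [IsProbabilityMeasure P] in
-- Independence factorises the expectation; the argument -z undoes the sign in the definition of
-- `Y`.
lemma complexMGF_Y (hW_indep : iIndepFun W P) (hW_law : ∀ j, IdentDistrib (W j) V P P)
    (k : ℕ) (z : ℂ) :
    complexMGF (SplitTree.Y W k) P (-z) = complexMGF (fun ω => Real.log (V ω)) P z ^ k := by
  have hm : Measurable fun x : ℝ => Complex.exp (z * (Real.log x : ℝ)) := by fun_prop
  have hind : iIndepFun (fun i : Fin k => W i) P := hW_indep.precomp Fin.val_injective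
  have h := hind.integral_fun_prod_comp (f := fun _ x => Complex.exp (z * (Real.log x : ℝ)))
    (fun i => (hW_law i).aemeasurable_fst) fun i => hm.aestronglyMeasurable
  have h2 : ∀ j, ∫ ω, Complex.exp (z * (Real.log (W j ω) : ℝ)) ∂P =
      complexMGF (fun ω => Real.log (V ω)) P z := fun j => ((hW_law j).comp hm).integral_eq
  simp only [h2, Finset.prod_const, Finset.card_univ, Fintype.card_fin] at h
  rw [← h]
  refine integral_congr_ae (Eventually.of_forall fun ω => ?_)
  simp only [SplitTree.Y, ← Complex.exp_sum]
  rw [Fin.sum_univ_eq_sum_range (fun j => z * (Real.log (W j ω) : ℝ)) k, ← Finset.mul_sum]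
  push_cast
  ring_nf

omit [IsProbabilityMeasure P] in
lemma mgf_Y (hW_indep : iIndepFun W P) (hW_law : ∀ j, IdentDistrib (W j) V P P)
    (k : ℕ) (s : ℝ) :
    mgf (SplitTree.Y W k) P (-s) = mgf (fun ω => Real.log (V ω)) P s ^ k := by
  have := complexMGF_Y hW_indep hW_law k s
  rw [← Complex.ofReal_neg, complexMGF_ofReal, complexMGF_ofReal] at this
  exact_mod_cast this

omit [IsProbabilityMeasure P] in
lemma nu_nonneg (b k : ℕ) (t : ℝ) : 0 ≤ SplitTree.nu P b W k t := by
  unfold SplitTree.nu; positivity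

lemma nu_mono (b k : ℕ) : Monotone (SplitTree.nu P b W k) := fun s t hst =>
  mul_le_mul_of_nonneg_left (measureReal_mono fun _ h => le_trans h hst) (by positivity)

/-- The Chernoff bound for the summands of the renewal function. -/
lemma nu_le (hW_indep : iIndepFun W P) (hW_law : ∀ j, IdentDistrib (W j) V P P)
    (hV : ∀ᵐ ω ∂P, V ω ∈ Set.Ioo 0 1) (b k : ℕ) {s : ℝ} (hs : 0 ≤ s) (t : ℝ) :
    SplitTree.nu P b W k t ≤ (b * mgf (fun ω => Real.log (V ω)) P s) ^ k * Real.exp (s * t) := by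
  have hW01 : ∀ j, ∀ᵐ ω ∂P, W j ω ∈ Set.Ioo 0 1 := fun j =>
    (hW_law j).symm.ae_snd (p := fun x => x ∈ Set.Ioo (0 : ℝ) 1) measurableSet_Ioo hV
  have hi : Integrable (fun ω => Real.exp (-s * SplitTree.Y W k ω)) P := by
    refine Integrable.of_bound (C := 1)
      ((aemeasurable_Y (fun j => (hW_law j).aemeasurable_fst) k).const_mul
        _).exp.aestronglyMeasurable ?_
    filter_upwards [ae_nonneg_Y hW01 k] with ω h
    rw [Real.norm_of_nonneg (Real.exp_pos _).le]
    exact Real.exp_le_one_iff.mpr (by nlinarith)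
  have h := measure_le_le_exp_mul_mgf (X := SplitTree.Y W k) (μ := P) t (neg_nonpos.mpr hs) hi
  rw [mgf_Y hW_indep hW_law, neg_neg] at h
  rw [SplitTree.nu, mul_pow, mul_assoc, mul_comm (_ ^ k) (Real.exp _)]
  exact mul_le_mul_of_nonneg_left h (by positivity)

lemma laplace_nu (hW_indep : iIndepFun W P) (hW_law : ∀ j, IdentDistrib (W j) V P P)
    (hV : ∀ᵐ ω ∂P, V ω ∈ Set.Ioo 0 1) (b k : ℕ) {z : ℂ} (hz : 0 < z.re) :
    IntegrableOn (fun t : ℝ => (SplitTree.nu P b W k t : ℂ) * Complex.exp (-(z * t)))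
      (Set.Ioi 0) ∧
    ∫ t in Set.Ioi (0 : ℝ), (SplitTree.nu P b W k t : ℂ) * Complex.exp (-(z * t)) =
      (b * complexMGF (fun ω => Real.log (V ω)) P z) ^ k / z := by
  have hW01 : ∀ j, ∀ᵐ ω ∂P, W j ω ∈ Set.Ioo 0 1 := fun j =>
    (hW_law j).symm.ae_snd (p := fun x => x ∈ Set.Ioo (0 : ℝ) 1) measurableSet_Ioo hV
  have hY := aemeasurable_Y (fun j => (hW_law j).aemeasurable_fst) k
  have : IsProbabilityMeasure (P.map (SplitTree.Y W k)) := Measure.isProbabilityMeasure_map hY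
  have h0 : ∀ᵐ y ∂P.map (SplitTree.Y W k), 0 ≤ y :=
    (ae_map_iff hY measurableSet_Ici).mpr (ae_nonneg_Y hW01 k)
  obtain ⟨h1, h2⟩ := integral_measureReal_Iic_mul_exp h0 hz
  have hnu : ∀ t : ℝ, (SplitTree.nu P b W k t : ℂ) * Complex.exp (-(z * t)) =
      (b : ℂ) ^ k * (((P.map (SplitTree.Y W k)).real (Set.Iic t) : ℂ) *
        Complex.exp (-(z * t))) := fun t => by
    rw [map_measureReal_apply_of_aemeasurable hY measurableSet_Iic, SplitTree.nu]
    push_cast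
    exact mul_assoc _ _ _
  simp_rw [hnu]
  refine ⟨h1.const_mul _, ?_⟩
  have h3 : ∫ y, Complex.exp (-(z * y)) ∂P.map (SplitTree.Y W k) =
      complexMGF (SplitTree.Y W k) P (-z) := by
    simp_rw [← neg_mul]
    exact congrFun (complexMGF_id_map hY) (-z)
  rw [integral_const_mul, h2, h3, complexMGF_Y hW_indep hW_law, mul_pow, mul_div_assoc]

end Walk

/-! ### The renewal function and its transform. -/

section Renewal

variable {Ω : Type*} [MeasurableSpace Ω] {P : Measure Ω} [IsProbabilityMeasure P]
  {V : Ω → ℝ} {W : ℕ → Ω → ℝ} {b : ℕ}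

omit [IsProbabilityMeasure P] in
lemma mul_mgf_log_nonneg (b : ℕ) (s : ℝ) : 0 ≤ b * mgf (fun ω => Real.log (V ω)) P s :=
  mul_nonneg b.cast_nonneg mgf_nonneg

lemma mul_mgf_log_lt_one (hVm : AEMeasurable V P) (hV : ∀ᵐ ω ∂P, V ω ∈ Set.Ioo 0 1)
    (hb : (b : ℝ) * ∫ ω, V ω ∂P = 1) {s : ℝ} (hs : 1 < s) :
    b * mgf (fun ω => Real.log (V ω)) P s < 1 := by
  have hb0 : (0 : ℝ) < b := b.cast_nonneg.lt_of_ne fun h => by simp [← h] at hb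
  rw [← hb, ← mgf_log_one hV]
  exact mul_lt_mul_of_pos_left (mgf_log_lt hVm hV hs) hb0

lemma summable_nu (hW_indep : iIndepFun W P) (hW_law : ∀ j, IdentDistrib (W j) V P P)
    (hV : ∀ᵐ ω ∂P, V ω ∈ Set.Ioo 0 1) (hb : (b : ℝ) * ∫ ω, V ω ∂P = 1) (t : ℝ) :
    Summable fun k => SplitTree.nu P b W (k + 1) t := by
  -- Any exponent above 1 gives a geometric majorant; 2 is a convenient choice.
  have hlt := mul_mgf_log_lt_one (hW_law 0).aemeasurable_snd hV hb one_lt_two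
  refine Summable.of_nonneg_of_le (fun k => nu_nonneg b _ t)
    (fun k => nu_le hW_indep hW_law hV b (k + 1) zero_le_two t) ?_
  exact ((summable_nat_add_iff 1).mpr
    (summable_geometric_of_lt_one (mul_mgf_log_nonneg b 2) hlt)).mul_right _

omit [IsProbabilityMeasure P] in
lemma renewalU_nonneg (t : ℝ) : 0 ≤ SplitTree.renewalU P b W t :=
  tsum_nonneg fun k => nu_nonneg b (k + 1) t

lemma renewalU_mono (hW_indep : iIndepFun W P) (hW_law : ∀ j, IdentDistrib (W j) V P P)
    (hV : ∀ᵐ ω ∂P, V ω ∈ Set.Ioo 0 1) (hb : (b : ℝ) * ∫ ω, V ω ∂P = 1) :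
    Monotone (SplitTree.renewalU P b W) := fun _ _ hst =>
  (summable_nu hW_indep hW_law hV hb _).tsum_le_tsum (fun k => nu_mono b (k + 1) hst)
    (summable_nu hW_indep hW_law hV hb _)

lemma exists_renewalU_le (hW_indep : iIndepFun W P) (hW_law : ∀ j, IdentDistrib (W j) V P P)
    (hV : ∀ᵐ ω ∂P, V ω ∈ Set.Ioo 0 1) (hb : (b : ℝ) * ∫ ω, V ω ∂P = 1) {s : ℝ} (hs : 1 < s) :
    ∃ C, ∀ t, SplitTree.renewalU P b W t ≤ C * Real.exp (s * t) := by
  have hlt := mul_mgf_log_lt_one (hW_law 0).aemeasurable_snd hV hb hs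
  have hsum := (summable_nat_add_iff 1).mpr
    (summable_geometric_of_lt_one (mul_mgf_log_nonneg b s) hlt)
  refine ⟨∑' k : ℕ, (b * mgf (fun ω => Real.log (V ω)) P s) ^ (k + 1), fun t => ?_⟩
  rw [← tsum_mul_right]
  exact (summable_nu hW_indep hW_law hV hb t).tsum_le_tsum
    (fun k => nu_le hW_indep hW_law hV b (k + 1) (by linarith) t) (hsum.mul_right _)

lemma integrableOn_renewalU (hW_indep : iIndepFun W P)
    (hW_law : ∀ j, IdentDistrib (W j) V P P) (hV : ∀ᵐ ω ∂P, V ω ∈ Set.Ioo 0 1)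
    (hb : (b : ℝ) * ∫ ω, V ω ∂P = 1) {ε : ℝ} (hε : 0 < ε) :
    IntegrableOn (fun t => SplitTree.renewalU P b W t * Real.exp (-t) * Real.exp (-(ε * t)))
      (Set.Ioi 0) := by
  -- Growth exponent 1 + ε/2 leaves the integrable factor e^{-εt/2}.
  obtain ⟨C, hC⟩ := exists_renewalU_le hW_indep hW_law hV hb (by linarith : 1 < 1 + ε / 2)
  have hm := (renewalU_mono hW_indep hW_law hV hb).measurable
  refine Integrable.mono'
    ((integrableOn_exp_mul_Ioi (by linarith : -(ε / 2) < 0) 0).const_mul C)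
    (Measurable.aestronglyMeasurable (by fun_prop)) (Eventually.of_forall fun t => ?_)
  have h0 : 0 ≤ SplitTree.renewalU P b W t := renewalU_nonneg t
  rw [Real.norm_of_nonneg (by positivity), mul_assoc, ← Real.exp_add]
  refine (mul_le_mul_of_nonneg_right (hC t) (Real.exp_pos _).le).trans_eq ?_
  rw [mul_assoc, ← Real.exp_add]
  ring_nf

/-- The Laplace transform of the renewal function. -/
lemma laplace_renewalU (hW_indep : iIndepFun W P) (hW_law : ∀ j, IdentDistrib (W j) V P P)
    (hV : ∀ᵐ ω ∂P, V ω ∈ Set.Ioo 0 1) (hb : (b : ℝ) * ∫ ω, V ω ∂P = 1) {z : ℂ}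
    (hz : 1 < z.re) :
    ‖b * complexMGF (fun ω => Real.log (V ω)) P z‖ < 1 ∧
    ∫ t in Set.Ioi (0 : ℝ), (SplitTree.renewalU P b W t : ℂ) * Complex.exp (-(z * t)) =
      b * complexMGF (fun ω => Real.log (V ω)) P z /
        (1 - b * complexMGF (fun ω => Real.log (V ω)) P z) / z := by
  set φ := b * complexMGF (fun ω => Real.log (V ω)) P z with hφ
  have hlt := mul_mgf_log_lt_one (hW_law 0).aemeasurable_snd hV hb hz
  have hφ1 : ‖φ‖ < 1 := by
    rw [hφ, norm_mul, Complex.norm_natCast]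
    exact (mul_le_mul_of_nonneg_left norm_complexMGF_le_mgf b.cast_nonneg).trans_lt hlt
  have hz0 : 0 < z.re := by linarith
  have hl := fun k => laplace_nu hW_indep hW_law hV b (k + 1) hz0
  -- The norm of each term is the same integrand at the real point Re z, so the L¹ norms form a
  -- geometric series and sum and integral may be exchanged.
  have hnorm : ∀ k, ∫ t in Set.Ioi (0 : ℝ),
      ‖(SplitTree.nu P b W (k + 1) t : ℂ) * Complex.exp (-(z * t))‖ =
      (b * mgf (fun ω => Real.log (V ω)) P z.re) ^ (k + 1) / z.re := fun k => by
    have h := (laplace_nu hW_indep hW_law hV b (k + 1) (z := (z.re : ℂ)) (by simpa using hz0)).2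
    rw [complexMGF_ofReal] at h
    apply Complex.ofReal_injective
    rw [← integral_complex_ofReal]
    push_cast
    rw [← h]
    refine integral_congr_ae (Eventually.of_forall fun t => ?_)
    beta_reduce
    rw [norm_mul, Complex.norm_exp, Complex.norm_real, Real.norm_of_nonneg (nu_nonneg b (k + 1) t),
      Complex.neg_re, Complex.re_mul_ofReal]
    push_cast
    rfl
  have hsum := hasSum_integral_of_summable_integral_norm (fun k => (hl k).1) (by
    simp_rw [hnorm]
    exact ((summable_nat_add_iff 1).mpr (summable_geometric_of_lt_one
      (mul_mgf_log_nonneg b _) hlt)).div_const _)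
  refine ⟨hφ1, ?_⟩
  have hgeom : HasSum (fun k => φ ^ (k + 1) / z) (φ / (1 - φ) / z) := by
    simp_rw [pow_succ', div_eq_mul_inv φ (1 - φ)]
    exact ((hasSum_geometric_of_norm_lt_one hφ1).mul_left φ).div_const z
  simp_rw [fun k => (hl k).2] at hsum
  rw [← hsum.unique hgeom]
  refine integral_congr_ae (Eventually.of_forall fun t => ?_)
  simp only [tsum_mul_right, SplitTree.renewalU, Complex.ofReal_tsum]

lemma tendsto_renewalU_mul_exp_neg (hW_indep : iIndepFun W P)
    (hW_law : ∀ j, IdentDistrib (W j) V P P) (hV : ∀ᵐ ω ∂P, V ω ∈ Set.Ioo 0 1)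
    (hb : (b : ℝ) * ∫ ω, V ω ∂P = 1)
    (hlat : ¬ SplitTree.IsLattice P fun ω => -Real.log (V ω)) {μ : ℝ} (hμ0 : μ ≠ 0)
    (hμ : μ = b * ∫ ω, V ω * -Real.log (V ω) ∂P) :
    Tendsto (fun t => SplitTree.renewalU P b W t * Real.exp (-t)) atTop (𝓝 μ⁻¹) := by
  have hVm : AEMeasurable V P := (hW_law 0).aemeasurable_snd
  have hbC : (b : ℂ) * ((∫ ω, V ω ∂P : ℝ) : ℂ) = 1 := by exact_mod_cast hb
  have hb0 : (b : ℂ) ≠ 0 := left_ne_zero_of_mul_eq_one hbC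
  set L : Ω → ℝ := fun ω => Real.log (V ω)
  set Φ : ℂ → ℂ := fun z => b * complexMGF L P (1 + z) with hΦdef
  have hΦ : DifferentiableOn ℂ Φ {z | -1 < z.re} := by
    refine DifferentiableOn.const_mul ?_ _
    refine differentiableOn_complexMGF.comp (by fun_prop) fun z hz => ?_
    have hz' : -1 < z.re := hz
    exact mem_interior_integrableExpSet_log hVm hV (by simp; linarith)
  have h0 : Φ 0 = 1 := by
    have : complexMGF L P 1 = mgf L P 1 := by
      rw [← complexMGF_ofReal, Complex.ofReal_one]
    rw [hΦdef]
    simp only [add_zero, this, L, mgf_log_one hV, hbC]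
  have hd : deriv Φ 0 = -μ := by
    have h1 := hasDerivAt_complexMGF_log_one hVm hV
    rw [← add_zero (1 : ℂ)] at h1
    have h2 := (h1.comp_const_add 1 0).const_mul (b : ℂ)
    rw [h2.deriv, hμ]
    push_cast
    ring
  have hne : ∀ z : ℂ, 0 ≤ z.re → z ≠ 0 → Φ z ≠ 1 := by
    intro z hz hz0 h
    -- On the boundary line the non-lattice hypothesis excludes the value 1; inside, ‖Φ z‖ < 1.
    rcases hz.eq_or_lt with hre | hre
    · have hzI : z = Complex.I * z.im := by
        apply Complex.ext <;> simp [← hre]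
      have him : z.im ≠ 0 := fun h => hz0 (by rw [hzI, h]; simp)
      refine complexMGF_log_one_add_I_mul_ne hVm hV hlat him ?_
      rw [← hzI]
      exact mul_left_cancel₀ hb0 (h.trans hbC.symm)
    · have := (laplace_renewalU hW_indep hW_law hV hb (z := 1 + z) (by simpa using hre)).1
      rw [show (b : ℂ) * complexMGF (fun ω => Real.log (V ω)) P (1 + z) = 1 from h] at this
      simp at this
  obtain ⟨H, hH, hHz⟩ := exists_continuousOn_eq_add_pole hμ0 hΦ h0 hd hne
  refine wiener_ikehara (renewalU_mono hW_indep hW_law hV hb) renewalU_nonneg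
    (fun ε hε => integrableOn_renewalU hW_indep hW_law hV hb hε) hH fun z hz => ?_
  rw [← hHz z hz]
  rw [← (laplace_renewalU hW_indep hW_law hV hb (z := 1 + z) (by simpa using hz)).2]
  refine integral_congr_ae (Eventually.of_forall fun t => ?_)
  simp only
  rw [show -((1 + z) * (t : ℂ)) = -(t : ℂ) + -(z * t) by ring, Complex.exp_add]
  push_cast
  ring

end Renewal

/-! ### The main theorem. -/

/-- The renewal series converges, `μ` is a finite positive number, and
`U(t) = (μ⁻¹ + o(1)) e^t` as `t → ∞`. -/
theorem mainTheorem7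
    {Ω₀ : Type*} [MeasurableSpace Ω₀] (P₀ : Measure Ω₀) [IsProbabilityMeasure P₀]
    {Ω : Type*} [MeasurableSpace Ω] (P : Measure Ω) [IsProbabilityMeasure P]
    (b : ℕ) (S : Ω₀ → Fin b → ℝ) (hS : SplitTree.IsSplitVector P₀ S)
    (V : Ω → ℝ) (hV : ∀ i, IdentDistrib V (fun ω => S ω i) P P₀)
    (hV_one : ∀ᵐ ω ∂P, V ω ≠ 1) (hV_zero : ∀ᵐ ω ∂P, V ω ≠ 0)
    (hV_lattice : ¬ SplitTree.IsLattice P (fun ω => -Real.log (V ω)))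
    (W : ℕ → Ω → ℝ) (hW_indep : iIndepFun W P) (hW_law : ∀ j, IdentDistrib (W j) V P P) :
    (∀ t : ℝ, Summable (fun k : ℕ => SplitTree.nu P b W (k + 1) t)) ∧
    Integrable (fun x : ℝ => -Real.log x) (SplitTree.sizeBiasedLaw P₀ S) ∧
    0 < SplitTree.mu P₀ S ∧
    ∃ ε : ℝ → ℝ, Tendsto ε atTop (𝓝 0) ∧
      ∀ t : ℝ, SplitTree.renewalU P b W t = ((SplitTree.mu P₀ S)⁻¹ + ε t) * Real.exp t := by

  have hV01 := hS.ae_mem_Ioo hV hV_one hV_zero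
  have hb := hS.mul_integral_eq_one hV
  have hVm : AEMeasurable V P := (hW_law 0).aemeasurable_snd
  have hbound : ∀ᵐ ω ∂P, 0 < V ω * -Real.log (V ω) ∧ V ω * -Real.log (V ω) ≤ 1 := by
    filter_upwards [hV01] with ω h
    refine ⟨mul_pos h.1 (neg_pos.mpr (Real.log_neg h.1 h.2)), ?_⟩
    -- Multiplying 1 - 1/v ≤ log v by v gives -v log v ≤ 1 - v ≤ 1, which makes μ finite.
    have h1 := mul_le_mul_of_nonneg_left (Real.one_sub_inv_le_log_of_pos h.1) h.1.le
    rw [mul_sub, mul_inv_cancel₀ h.1.ne'] at h1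
    linarith [h.1]
  have hi : Integrable (fun ω => V ω * -Real.log (V ω)) P := by
    refine Integrable.of_bound (C := 1)
      (hVm.mul (Real.measurable_log.comp_aemeasurable hVm).neg).aestronglyMeasurable ?_
    filter_upwards [hbound] with ω h
    rw [Real.norm_of_nonneg h.1.le]
    exact h.2
  obtain ⟨hint, hmu⟩ := hS.integral_sizeBiasedLaw hV (f := fun x => -Real.log x)
    Real.measurable_log.neg hi
  have hmu' : SplitTree.mu P₀ S = b * ∫ ω, V ω * -Real.log (V ω) ∂P := hmu
  have hpos : 0 < SplitTree.mu P₀ S := by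
    rw [hmu']
    exact mul_pos (by exact_mod_cast hS.pos) (integral_pos_of_ae_pos hi (hbound.mono fun _ h => h.1))
  refine ⟨summable_nu hW_indep hW_law hV01 hb, hint, hpos,
    fun t => SplitTree.renewalU P b W t * Real.exp (-t) - (SplitTree.mu P₀ S)⁻¹, ?_, fun t => ?_⟩
  · simpa using (tendsto_renewalU_mul_exp_neg hW_indep hW_law hV01 hb hV_lattice hpos.ne'
      hmu').sub_const (SplitTree.mu P₀ S)⁻¹
  · rw [add_sub_cancel, mul_assoc, ← Real.exp_add, neg_add_cancel, Real.exp_zero, mul_one]
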